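/- Write $e(t)=\exp(2\pi i t)$ and, for an integer $d\ge 2$, $x\in\mathbb{R}$ and $N\in\mathbb{N}=\{1,2,\dots\}$, let $\sigma_d(x;N)=\sum_{n=1}^{N} e(xn^d)$. For $0<\alpha<1$ let $$\mathscr{E}_{\alpha,d}=\{x\in[0,1): |\sigma_d(x;N)|\ge N^{\alpha}\text{ for infinitely many } N\in\mathbb{N}\}.$$ Then for each $0<\alpha<1$, the Hausdorff dimension $\dim$ of these sets satisfies (i) for $d=2$, $$\dim \mathscr{E}_{\alpha,2}\ge \min\left\{\frac{4}{5},\,\frac{4(1-\alpha)}{3-\alpha}\right\};$$ (ii) for every integer $d\ge 3$, $$\dim \mathscr{E}_{\alpha,d}\ge \min\left\{\frac{d+1}{d^{2}+1},\,\frac{(d+1)(1-\alpha)}{d+1-\alpha}\right\}.$$ -/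

import Mathlib

/-- The additive character `e(t) = exp(2π i t)`. -/
noncomputable def expChar (t : ℝ) : ℂ :=
  Complex.exp (2 * (Real.pi : ℂ) * Complex.I * (t : ℂ))

/-- The monomial sum `σ_d(x; N) = ∑_{n=1}^N e(x n^d)`. -/
noncomputable def monomialSum (d : ℕ) (x : ℝ) (N : ℕ) : ℂ :=
  ∑ n ∈ Finset.Icc 1 N, expChar (x * (n : ℝ) ^ d)

/-- The set of `x ∈ [0, 1)` such that `|σ_d(x; N)| ≥ N^α` for infinitely many positive
integers `N`. -/
def exceptionalSet (α : ℝ) (d : ℕ) : Set ℝ :=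
  {x : ℝ | x ∈ Set.Ico (0 : ℝ) 1 ∧
    {N : ℕ | 1 ≤ N ∧ (N : ℝ) ^ α ≤ ‖monomialSum d x N‖}.Infinite}

/-! Large sums come from fractions `a / q` with `q = p ^ D`, `p` prime and `p ∤ a`: over `t` full
periods the sum at `a / q` has modulus at least `t q p ^ (-b)`. For `d = 2` one takes `D = 1`, `b =
1/2` (quadratic Gauss sums); for `d ≥ 3`, `D = d` and `b = 1`, since only the multiples of `p`
survive in the complete sum modulo `p ^ d`. With `τ = 1 / (1 - α)` and `N ≈ (2 p ^ b) ^ τ` this is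
at least `2 N ^ α`. Moving from `a / q` to `x` costs `O(|x - a / q| N ^ (d + 1))`, so half of the
main term survives if `|x - a / q| ≤ n ^ (-ρ)` with `p` of order `n` large and `ρ > b (τ d + 1)`
(`mem_exceptionalSet_of_isApproxBy`).

It remains to bound from below the dimension of the points approximated in this way for arbitrarily
large `n`. Up to logarithms there are `n ^ (D + 1)` fractions per unit length, which suggests `(D +
1) / ρ`; this is correct if they do not cluster (`le_dimH_isApproxBy`). No measure is constructed:
against a cover of small `s`-weight one picks nested balls, each met only lightly by the cover, and
their common point escapes it (`exists_forall_notMem_closedBall`).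

A full period fits into `N` when `D ≤ b τ`, that is, `α ≥ 1/2` for `d = 2` and `α ≥ 1 - 1/d` for `d
≥ 3`. For smaller `α` the sets only grow, which gives the constant terms in the minima. -/

/-- A `g`-separated family of reals inside an interval of radius `L` has at most `1 + 2L/g`
members. -/
theorem card_le_of_separated {ι : Type*} (F : Finset ι) (f : ι → ℝ) {g L u : ℝ} (hg : 0 < g)
    (hsep : ∀ i ∈ F, ∀ j ∈ F, i ≠ j → g ≤ |f i - f j|) (hF : ∀ i ∈ F, |f i - u| ≤ L)
    (hL : 0 ≤ L) : (F.card : ℝ) ≤ 1 + 2 * L / g := by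
  classical
  have hmaps : ∀ i ∈ F, ⌊(f i - (u - L)) / g⌋₊ ∈ Finset.range (⌊2 * L / g⌋₊ + 1) := by
    intro i hi
    rw [Finset.mem_range, Nat.lt_succ_iff]
    apply Nat.floor_le_floor
    have := (abs_le.1 (hF i hi)).2
    gcongr
    linarith
  have hinj : Set.InjOn (fun i => ⌊(f i - (u - L)) / g⌋₊) (F : Set ι) := by
    intro i hi j hj hij
    by_contra hne
    have hi0 : 0 ≤ (f i - (u - L)) / g := by
      have := (abs_le.1 (hF i hi)).1
      apply div_nonneg _ hg.le
      linarith
    have hj0 : 0 ≤ (f j - (u - L)) / g := by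
      have := (abs_le.1 (hF j hj)).1
      apply div_nonneg _ hg.le
      linarith
    have h1 := Nat.floor_le hi0
    have h2 := Nat.floor_le hj0
    have h3 := Nat.lt_floor_add_one ((f i - (u - L)) / g)
    have h4 := Nat.lt_floor_add_one ((f j - (u - L)) / g)
    simp only at hij
    rw [hij] at h1 h3
    have h5 : |(f i - (u - L)) / g - (f j - (u - L)) / g| < 1 := by
      rw [abs_lt]; constructor <;> linarith
    rw [← sub_div, abs_div, abs_of_pos hg, div_lt_one hg] at h5
    have h6 := hsep i hi j hj hne
    rw [show f i - (u - L) - (f j - (u - L)) = f i - f j by ring] at h5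
    linarith
  have hcard := Finset.card_le_card_of_injOn _ hmaps hinj
  rw [Finset.card_range] at hcard
  have : ((⌊2 * L / g⌋₊ : ℕ) : ℝ) ≤ 2 * L / g := Nat.floor_le (by positivity)
  have h2 : (F.card : ℝ) ≤ (⌊2 * L / g⌋₊ : ℕ) + 1 := by exact_mod_cast hcard
  linarith

/-! ### Dimension bounds from nested balls that escape every light cover -/

/-- The `s`-weight of those balls `closedBall (u k) (ℓ k)` that meet `closedBall c r`. -/
noncomputable def hitWeight (s : ℝ) (u ℓ : ℕ → ℝ) (c r : ℝ) : ℝ :=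
  ∑' k, if |c - u k| ≤ ℓ k + r then ℓ k ^ s else 0

/-- The points `y i`, `i ∈ F`, are well enough spread at scales between `w` and `r` that a cover of
small `s`-weight must leave one of the balls `closedBall (y i) w` sparsely covered. -/
def IsSpread {ι : Type*} (s C : ℝ) (y : ι → ℝ) (F : Finset ι) (r w : ℝ) : Prop :=
  0 < F.card ∧ ∀ u ℓ : ℝ, 0 < ℓ → ℓ ≤ r / C →
    min 1 ((ℓ * C / w) ^ s) * ((F.filter fun i => |y i - u| ≤ ℓ + w).card : ℝ) ≤
      (F.card : ℝ) / 2 * (ℓ * C / r) ^ s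

/-- Averaging over `F`: if every sub-ball were too heavily met, the truncated weights summed over
`F` would be at least `F.card`, while exchanging the sums and applying `IsSpread` to each covering
ball bounds them by `F.card / 2`. -/
theorem exists_hitWeight_le {ι : Type*} {s C c r w : ℝ} {y : ι → ℝ} {F : Finset ι}
    {u ℓ : ℕ → ℝ} (hs : 0 < s) (hC : 0 < C) (hr : 0 < r) (hw : 0 < w) (hwr : w ≤ r / 2)
    (hℓ : ∀ k, 0 < ℓ k) (hsum : Summable fun k => ℓ k ^ s) (hF : ∀ i ∈ F, |y i - c| ≤ r / 2)
    (hspread : IsSpread s C y F r w) (hgood : hitWeight s u ℓ c r ≤ (r / C) ^ s) :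
    ∃ i ∈ F, hitWeight s u ℓ (y i) w ≤ (w / C) ^ s := by
  classical
  by_contra! hbad
  have hnn : ∀ k, 0 ≤ ℓ k ^ s := fun k => Real.rpow_nonneg (hℓ k).le _
  have hsumI : ∀ P : ℕ → Prop, Summable fun k => if P k then ℓ k ^ s else 0 := by
    intro P
    refine Summable.of_nonneg_of_le (fun k => ?_) (fun k => ?_) hsum
    · split_ifs <;> simp [hnn]
    · split_ifs <;> simp [hnn]
  have hℓr : ∀ k, |c - u k| ≤ ℓ k + r → ℓ k ≤ r / C := by
    intro k hk
    have h1 : ℓ k ^ s ≤ (r / C) ^ s := by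
      refine le_trans ?_ hgood
      have := (hsumI fun k => |c - u k| ≤ ℓ k + r).le_tsum k
        (fun j _ => by split_ifs <;> simp [hnn])
      simpa [hk, hitWeight] using this
    exact (Real.rpow_le_rpow_iff (hℓ k).le (by positivity) hs).1 h1
  have hexp : ∀ k, (ℓ k * C / w) ^ s = ℓ k ^ s / (w / C) ^ s := by
    intro k
    rw [← Real.div_rpow (hℓ k).le (by positivity)]
    congr 1
    field_simp
  have hexp' : ∀ k, (ℓ k * C / r) ^ s = ℓ k ^ s / (r / C) ^ s := by
    intro k
    rw [← Real.div_rpow (hℓ k).le (by positivity)]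
    congr 1
    field_simp
  have hwC : 0 < (w / C) ^ s := by positivity
  have hrC : 0 < (r / C) ^ s := by positivity
  -- Weights relative to scale `w`, cut off at 1 so that one long covering interval is not
  -- overcounted. A heavily met sub-ball still collects at least 1: either one term reaches the
  -- cutoff, or no term is cut.
  set g : ℕ → ℝ := fun k => min 1 ((ℓ k * C / w) ^ s) with hgdef
  have hg0 : ∀ k, 0 ≤ g k := fun k =>
    le_min zero_le_one (Real.rpow_nonneg (by have := hℓ k; positivity) _)
  have hgsum : Summable g := by
    refine Summable.of_nonneg_of_le hg0 (fun k => ?_) (hsum.div_const ((w / C) ^ s))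
    rw [← hexp]; exact min_le_right _ _
  have hgI : ∀ i, Summable fun k => if |y i - u k| ≤ ℓ k + w then g k else 0 := by
    intro i
    refine Summable.of_nonneg_of_le (fun k => ?_) (fun k => ?_) hgsum
    · split_ifs <;> simp [hg0]
    · split_ifs <;> simp [hg0]
  have hone : ∀ i ∈ F, 1 ≤ ∑' k, if |y i - u k| ≤ ℓ k + w then g k else 0 := by
    intro i hi
    by_cases hex : ∃ k, |y i - u k| ≤ ℓ k + w ∧ 1 ≤ (ℓ k * C / w) ^ s
    · obtain ⟨k, hk, hk1⟩ := hex
      have := (hgI i).le_tsum k (fun j _ => by split_ifs <;> simp [hg0])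
      rw [if_pos hk] at this
      have h2 : g k = 1 := min_eq_left hk1
      linarith
    · push Not at hex
      have heq : (∑' k, if |y i - u k| ≤ ℓ k + w then g k else 0)
          = hitWeight s u ℓ (y i) w / (w / C) ^ s := by
        rw [hitWeight, ← tsum_div_const]
        refine tsum_congr fun k => ?_
        split_ifs with h
        · rw [← hexp]; exact min_eq_right (hex k h).le
        · simp
      rw [heq, le_div_iff₀ hwC, one_mul]
      exact (hbad i hi).le
  have h1 : (F.card : ℝ) ≤ ∑ i ∈ F, ∑' k, if |y i - u k| ≤ ℓ k + w then g k else 0 := by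
    have := Finset.sum_le_sum hone
    simpa using this
  rw [← Summable.tsum_finsetSum (fun i _ => hgI i)] at h1
  have h2 : ∀ k, (∑ i ∈ F, if |y i - u k| ≤ ℓ k + w then g k else 0) ≤
      (F.card : ℝ) / 2 / (r / C) ^ s * (if |c - u k| ≤ ℓ k + r then ℓ k ^ s else 0) := by
    intro k
    rw [← Finset.sum_filter, Finset.sum_const, nsmul_eq_mul]
    split_ifs with h
    · have := hspread.2 (u k) (ℓ k) (hℓ k) (hℓr k h)
      rw [hexp'] at this
      calc _ = g k * ((F.filter fun i => |y i - u k| ≤ ℓ k + w).card : ℝ) := mul_comm _ _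
        _ ≤ _ := this
        _ = _ := by ring
    · have : F.filter (fun i => |y i - u k| ≤ ℓ k + w) = ∅ := by
        rw [Finset.filter_eq_empty_iff]
        intro i hi hle
        apply h
        have := abs_sub_le c (y i) (u k)
        have h3 := hF i hi
        rw [abs_sub_comm] at h3
        linarith
      rw [this]; simp
  have h3 : (∑' k, ∑ i ∈ F, if |y i - u k| ≤ ℓ k + w then g k else 0) ≤
      (F.card : ℝ) / 2 / (r / C) ^ s * hitWeight s u ℓ c r := by
    rw [hitWeight, ← tsum_mul_left]
    refine Summable.tsum_le_tsum h2 (summable_sum fun i _ => hgI i) ((hsumI _).mul_left _)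
  have hpos : (0 : ℝ) < F.card := by exact_mod_cast hspread.1
  have h4 : (F.card : ℝ) / 2 / (r / C) ^ s * hitWeight s u ℓ c r ≤ (F.card : ℝ) / 2 := by
    calc _ ≤ (F.card : ℝ) / 2 / (r / C) ^ s * (r / C) ^ s := by gcongr
      _ = _ := by field_simp
  linarith

/-- If every ball inside `closedBall c₀ r₀` has well spread sub-balls on which `Q m` holds, then no
sequence of balls of small total `s`-weight covers the points satisfying all `Q m`. -/
theorem exists_forall_notMem_closedBall {ι : Type*} {s C c₀ r₀ : ℝ} {y : ι → ℝ}
    {Q : ℕ → ℝ → Prop} {u ℓ : ℕ → ℝ} (hs : 0 < s) (hC : 0 < C) (hr₀ : 0 < r₀)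
    (hstep : ∀ c r : ℝ, 0 < r → ∀ m : ℕ, ∃ w > 0, w ≤ r / 2 ∧ ∃ F : Finset ι,
      (∀ i ∈ F, |y i - c| ≤ r / 2) ∧ (∀ i ∈ F, ∀ x, |x - y i| ≤ w → Q m x) ∧
      IsSpread s C y F r w)
    (hℓ : ∀ k, 0 < ℓ k) (hsum : Summable fun k => ℓ k ^ s)
    (hsmall : ∑' k, ℓ k ^ s ≤ (r₀ / C) ^ s) :
    ∃ x, |x - c₀| ≤ r₀ ∧ (∀ m, Q m x) ∧ ∀ k, ℓ k < |x - u k| := by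
  classical
  have hnn : ∀ k, 0 ≤ ℓ k ^ s := fun k => Real.rpow_nonneg (hℓ k).le _
  have hsumI : ∀ P : ℕ → Prop, Summable fun k => if P k then ℓ k ^ s else 0 := by
    intro P
    refine Summable.of_nonneg_of_le (fun k => ?_) (fun k => ?_) hsum
    · split_ifs <;> simp [hnn]
    · split_ifs <;> simp [hnn]
  -- The invariant kept along the nested sequence: the cover meets the ball with weight at most
  -- `(radius / C) ^ s`.
  let S := {z : ℝ × ℝ // 0 < z.2 ∧ hitWeight s u ℓ z.1 z.2 ≤ (z.2 / C) ^ s}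
  have hnext : ∀ (m : ℕ) (z : S), ∃ z' : S, z'.1.2 ≤ z.1.2 / 2 ∧ |z'.1.1 - z.1.1| ≤ z.1.2 / 2 ∧
      ∀ x, |x - z'.1.1| ≤ z'.1.2 → Q m x := by
    rintro m ⟨⟨c, r⟩, hr, hgood⟩
    obtain ⟨w, hw, hwr, F, hF, hQ, hspread⟩ := hstep c r hr m
    obtain ⟨i, hi, hgi⟩ := exists_hitWeight_le hs hC hr hw hwr hℓ hsum hF hspread hgood
    exact ⟨⟨(y i, w), hw, hgi⟩, hwr, hF i hi, hQ i hi⟩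
  choose next hnext1 hnext2 hnext3 using hnext
  have hz0 : hitWeight s u ℓ c₀ r₀ ≤ (r₀ / C) ^ s := by
    refine le_trans (Summable.tsum_le_tsum (fun k => ?_) (hsumI _) hsum) hsmall
    split_ifs <;> simp [hnn]
  let z : ℕ → S := fun n => Nat.rec ⟨(c₀, r₀), hr₀, hz0⟩ (fun m z => next m z) n
  have hz : ∀ n, z (n + 1) = next n (z n) := fun n => rfl
  have hanti : Antitone fun n => Metric.closedBall (z n).1.1 (z n).1.2 := by
    refine antitone_nat_of_succ_le fun n => ?_
    refine Metric.closedBall_subset_closedBall' ?_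
    have h1 := hnext1 n (z n)
    have h2 := hnext2 n (z n)
    rw [Real.dist_eq, hz]
    linarith
  have hrad : ∀ n, (z n).1.2 ≤ r₀ * (1 / 2) ^ n := by
    intro n
    induction n with
    | zero => simp [z]
    | succ n ih =>
      have h1 := hnext1 n (z n)
      rw [hz, pow_succ]
      linarith
  obtain ⟨x, hx⟩ := IsCompact.nonempty_iInter_of_sequence_nonempty_isCompact_isClosed
    (fun n => Metric.closedBall (z n).1.1 (z n).1.2) (fun n => hanti (Nat.le_succ n))
    (fun n => Metric.nonempty_closedBall.2 (z n).2.1.le) (isCompact_closedBall _ _)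
    (fun n => Metric.isClosed_closedBall)
  simp only [Set.mem_iInter, Metric.mem_closedBall, Real.dist_eq] at hx
  refine ⟨x, hx 0, fun m => hnext3 m (z m) x (by rw [← hz]; exact hx (m + 1)), fun k => ?_⟩
  -- A covering interval containing `x` meets every ball of the sequence, so the invariant bounds `ℓ
  -- k` by radii tending to 0.
  by_contra! hk
  have hle : ∀ n, ℓ k ≤ r₀ / C * (1 / 2) ^ n := by
    intro n
    have hhit : |(z n).1.1 - u k| ≤ ℓ k + (z n).1.2 := by
      have h1 := abs_sub_le (z n).1.1 x (u k)
      have h2 := hx n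
      rw [abs_sub_comm] at h2
      linarith
    have h1 : ℓ k ^ s ≤ ((z n).1.2 / C) ^ s := by
      refine le_trans ?_ (z n).2.2
      have := (hsumI fun k => |(z n).1.1 - u k| ≤ ℓ k + (z n).1.2).le_tsum k
        (fun j _ => by split_ifs <;> simp [hnn])
      simpa [hhit, hitWeight] using this
    have h2 := (Real.rpow_le_rpow_iff (hℓ k).le (div_nonneg (z n).2.1.le hC.le) hs).1 h1
    refine h2.trans ?_
    rw [div_mul_eq_mul_div]
    gcongr
    exact hrad n
  have hlim : Filter.Tendsto (fun n : ℕ => r₀ / C * (1 / 2 : ℝ) ^ n) Filter.atTop (nhds 0) := by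
    simpa using (tendsto_pow_atTop_nhds_zero_of_lt_one (by norm_num : (0 : ℝ) ≤ 1 / 2)
      (by norm_num)).const_mul (r₀ / C)
  exact absurd (ge_of_tendsto' hlim hle) (not_le.2 (hℓ k))

open MeasureTheory Measure in
/-- A set of reals of zero `s`-dimensional Hausdorff measure is covered by intervals of arbitrarily
small positive total `s`-weight. -/
theorem exists_cover_of_hausdorffMeasure_eq_zero {s : ℝ} (hs : 0 < s) {E : Set ℝ}
    (hE : μH[s] E = 0) {ε : ℝ} (hε : 0 < ε) :
    ∃ u ℓ : ℕ → ℝ, (∀ k, 0 < ℓ k) ∧ Summable (fun k => ℓ k ^ s) ∧ ∑' k, ℓ k ^ s ≤ ε ∧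
      ∀ x ∈ E, ∃ k, |x - u k| ≤ ℓ k := by
  classical
  rw [hausdorffMeasure_apply] at hE
  have h1 := ENNReal.iSup_eq_zero.1 hE 1
  simp only [zero_lt_one, iSup_pos] at h1
  have h2 : (⨅ (t : ℕ → Set ℝ) (_ : E ⊆ ⋃ n, t n) (_ : ∀ n, Metric.ediam (t n) ≤ 1),
      ∑' n, ⨆ _ : (t n).Nonempty, Metric.ediam (t n) ^ s) < ENNReal.ofReal (ε / 2) := by
    rw [h1]; simpa using hε
  simp only [iInf_lt_iff] at h2
  obtain ⟨t, htE, htd, ht⟩ := h2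
  have hle : ∀ n, Metric.ediam (t n) ^ s ≤ ⨆ _ : (t n).Nonempty, Metric.ediam (t n) ^ s := by
    intro n
    rcases (t n).eq_empty_or_nonempty with h | h
    · simp [h, hs]
    · simp [h]
  have hlt : ∑' n, Metric.ediam (t n) ^ s < ENNReal.ofReal (ε / 2) :=
    (ENNReal.tsum_le_tsum hle).trans_lt ht
  have hfin : ∀ n, Metric.ediam (t n) ≠ ⊤ := fun n => ne_top_of_le_ne_top (by simp) (htd n)
  set δ : ℕ → ℝ := fun n => (Metric.ediam (t n)).toReal with hδ
  have hδ0 : ∀ n, 0 ≤ δ n := fun n => ENNReal.toReal_nonneg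
  have hδs : ∀ n, (Metric.ediam (t n) ^ s).toReal = δ n ^ s := fun n =>
    (ENNReal.toReal_rpow _ _).symm
  have hδsum : Summable fun n => δ n ^ s := by
    simp_rw [← hδs]
    exact ENNReal.summable_toReal hlt.ne_top
  have hδle : ∑' n, δ n ^ s ≤ ε / 2 := by
    simp_rw [← hδs]
    rw [← ENNReal.tsum_toReal_eq]
    · exact ENNReal.toReal_le_of_le_ofReal (by positivity) hlt.le
    · exact fun n => ENNReal.rpow_ne_top_of_nonneg hs.le (hfin n)
  -- A geometric series is added to the weights to make all radii positive, even for sets of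
  -- diameter 0. Each interval is centred at a point of its set, so the diameter itself serves as
  -- radius; empty sets get the dummy centre 0.
  have hgeo : HasSum (fun n : ℕ => ε / 2 / 2 / 2 ^ n) (ε / 2) := hasSum_geometric_two' (ε / 2)
  have hℓs : ∀ n, ((δ n ^ s + ε / 2 / 2 / 2 ^ n) ^ s⁻¹) ^ s = δ n ^ s + ε / 2 / 2 / 2 ^ n := by
    intro n
    have := hδ0 n
    rw [Real.rpow_inv_rpow (by positivity) hs.ne']
  refine ⟨fun n => if h : (t n).Nonempty then h.some else 0,
    fun n => (δ n ^ s + ε / 2 / 2 / 2 ^ n) ^ s⁻¹, fun n => ?_, ?_, ?_, ?_⟩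
  · have := hδ0 n
    positivity
  · simp_rw [hℓs]
    exact hδsum.add hgeo.summable
  · simp_rw [hℓs]
    rw [hδsum.tsum_add hgeo.summable, hgeo.tsum_eq]
    linarith
  · intro x hx
    obtain ⟨n, hn⟩ := Set.mem_iUnion.1 (htE hx)
    have hne : (t n).Nonempty := ⟨x, hn⟩
    refine ⟨n, ?_⟩
    simp only [hne, dif_pos]
    have h3 : |x - hne.some| ≤ δ n := by
      have h4 := Metric.edist_le_ediam_of_mem hn hne.some_mem
      rw [← Real.dist_eq, dist_edist]
      exact ENNReal.toReal_mono (hfin n) h4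
    refine h3.trans ?_
    have h5 : δ n = (δ n ^ s) ^ s⁻¹ := (Real.rpow_rpow_inv (hδ0 n) hs.ne').symm
    calc δ n = (δ n ^ s) ^ s⁻¹ := h5
      _ ≤ _ := by
        have := hδ0 n
        refine Real.rpow_le_rpow (by positivity) ?_ (by positivity)
        have : 0 < ε / 2 / 2 / 2 ^ n := by positivity
        linarith

theorem le_dimH_of_isSpread {ι : Type*} {s C c₀ r₀ : ℝ} {y : ι → ℝ} {Q : ℕ → ℝ → Prop}
    (hs : 0 < s) (hC : 0 < C) (hr₀ : 0 < r₀)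
    (hstep : ∀ c r : ℝ, 0 < r → ∀ m : ℕ, ∃ w > 0, w ≤ r / 2 ∧ ∃ F : Finset ι,
      (∀ i ∈ F, |y i - c| ≤ r / 2) ∧ (∀ i ∈ F, ∀ x, |x - y i| ≤ w → Q m x) ∧
      IsSpread s C y F r w) :
    ENNReal.ofReal s ≤ dimH {x : ℝ | |x - c₀| ≤ r₀ ∧ ∀ m, Q m x} := by
  by_contra! hlt
  have h0 := hausdorffMeasure_of_dimH_lt (d := s.toNNReal) hlt
  rw [Real.coe_toNNReal s hs.le] at h0
  obtain ⟨u, ℓ, hℓ, hsum, hle, hcov⟩ := exists_cover_of_hausdorffMeasure_eq_zero hs h0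
    (ε := (r₀ / C) ^ s) (by positivity)
  obtain ⟨x, hx, hxQ, hxu⟩ := exists_forall_notMem_closedBall (c₀ := c₀) (u := u) hs hC hr₀ hstep
    hℓ hsum hle
  obtain ⟨k, hk⟩ := hcov x ⟨hx, hxQ⟩
  exact absurd hk (not_le.2 (hxu k))

/-! ### Counting and separating fractions with prime power denominators -/

open Filter in
theorem eventually_le_natCast_rpow {a : ℝ} (ha : 0 < a) (M : ℝ) :
    ∀ᶠ n : ℕ in atTop, M ≤ (n : ℝ) ^ a :=
  ((tendsto_rpow_atTop ha).comp tendsto_natCast_atTop_atTop).eventually_ge_atTop M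

/-- The primes in `(n, 4n]`. -/
def primesBetween (n : ℕ) : Finset ℕ := (Finset.Ioc n (4 * n)).filter Nat.Prime

open Filter Chebyshev in
-- Chebyshev's bounds for `θ` have constants `log 2` below and `log 4 = 2 log 2` above. The range up
-- to `4 n` leaves a main term `2 n log 2` in `θ(4n) - θ(n)`; up to `2 n` nothing would be left.
theorem eventually_rpow_le_card_primesBetween {κ : ℝ} (hκ : κ < 1) :
    ∀ᶠ n : ℕ in atTop, (n : ℝ) ^ κ ≤ (primesBetween n).card := by
  -- With `κ ≥ 1/2` the factor `√n` in the error term is absorbed by `n ^ κ`.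
  wlog hκ2 : 1 / 2 ≤ κ generalizing κ
  · filter_upwards [this (κ := 1 / 2) (by norm_num) le_rfl, eventually_ge_atTop 1] with n hn h1
    refine le_trans (Real.rpow_le_rpow_of_exponent_le (by exact_mod_cast h1) ?_) hn
    linarith
  have hlog : ∀ᶠ x : ℝ in atTop, ‖Real.log x‖ ≤ 1 / 30 * ‖x ^ (1 - κ)‖ :=
    (isLittleO_log_rpow_atTop (by linarith)).def (by norm_num)
  have htend : Tendsto (fun n : ℕ => 4 * (n : ℝ) + 1) atTop atTop :=
    tendsto_atTop_add_const_right _ _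
      (tendsto_natCast_atTop_atTop.const_mul_atTop (by norm_num : (0 : ℝ) < 4))
  filter_upwards [htend.eventually hlog, eventually_ge_atTop 1] with n hn h1
  have h1' : (1 : ℝ) ≤ n := by exact_mod_cast h1
  have hn0 : (0 : ℝ) < n := by linarith
  have hL0 : 0 ≤ Real.log (4 * n + 1) := Real.log_nonneg (by linarith)
  rw [Real.norm_of_nonneg hL0, Real.norm_of_nonneg (by positivity)] at hn
  have hpow : (4 * (n : ℝ) + 1) ^ (1 - κ) ≤ 5 * (n : ℝ) ^ (1 - κ) := by
    calc (4 * (n : ℝ) + 1) ^ (1 - κ) ≤ (5 * n) ^ (1 - κ) :=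
          Real.rpow_le_rpow (by linarith) (by linarith) (by linarith)
      _ = 5 ^ (1 - κ) * (n : ℝ) ^ (1 - κ) := Real.mul_rpow (by norm_num) hn0.le
      _ ≤ 5 ^ (1 : ℝ) * (n : ℝ) ^ (1 - κ) := by
          gcongr
          · norm_num
          · linarith
      _ = _ := by rw [Real.rpow_one]
  have hnκ : (n : ℝ) ^ κ * (n : ℝ) ^ (1 - κ) = n := by
    rw [← Real.rpow_add hn0]; simp
  have hmain : (n : ℝ) ^ κ * Real.log (4 * n + 1) ≤ n / 6 := by
    calc (n : ℝ) ^ κ * Real.log (4 * n + 1) ≤ (n : ℝ) ^ κ * (1 / 30 * (5 * (n : ℝ) ^ (1 - κ))) := by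
          gcongr; linarith
      _ = ((n : ℝ) ^ κ * (n : ℝ) ^ (1 - κ)) / 6 := by ring
      _ = _ := by rw [hnκ]
  have hone : 1 ≤ (n : ℝ) ^ κ := Real.one_le_rpow h1' (by linarith)
  have hsqrt : √(n : ℝ) ≤ (n : ℝ) ^ κ := by
    rw [Real.sqrt_eq_rpow]
    exact Real.rpow_le_rpow_of_exponent_le h1' hκ2
  have hlog4 : Real.log (4 * n) ≤ Real.log (4 * n + 1) :=
    Real.log_le_log (by linarith) (by linarith)
  have hlog40 : 0 < Real.log (4 * n) := Real.log_pos (by linarith)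
  have hθ1 := theta_ge (4 * n)
  have hθ2 := theta_le_log4_mul_x hn0.le
  have hsq4 : √(4 * (n : ℝ)) = 2 * √n := by
    rw [Real.sqrt_mul (by norm_num), show (4 : ℝ) = 2 ^ 2 by norm_num,
      Real.sqrt_sq (by norm_num)]
  have hl4 : Real.log 4 = 2 * Real.log 2 := by
    rw [show (4 : ℝ) = 2 ^ 2 by norm_num, Real.log_pow]; norm_num
  have hl2 := Real.log_two_gt_d9
  have hsplit : θ ((4 * n : ℕ) : ℝ) = θ (n : ℝ) + ∑ p ∈ primesBetween n, Real.log p := by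
    simp only [theta, Nat.floor_natCast, primesBetween]
    rw [← Finset.Ioc_union_Ioc_eq_Ioc (Nat.zero_le n) (by omega : n ≤ 4 * n),
      Finset.filter_union, Finset.sum_union]
    exact Finset.disjoint_filter_filter (Finset.Ioc_disjoint_Ioc_of_le le_rfl)
  have hsum : ∑ p ∈ primesBetween n, Real.log p ≤
      (primesBetween n).card * Real.log (4 * n) := by
    rw [← nsmul_eq_mul]
    refine Finset.sum_le_card_nsmul _ _ _ fun p hp => ?_
    simp only [primesBetween, Finset.mem_filter, Finset.mem_Ioc] at hp
    refine Real.log_le_log (by exact_mod_cast hp.2.pos) ?_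
    exact_mod_cast hp.1.2
  push_cast at hθ1 hsplit
  rw [hsq4] at hθ1
  rw [hl4] at hθ2
  have h4 : √(n : ℝ) * Real.log (4 * n) ≤ n / 6 := by
    refine le_trans ?_ hmain
    gcongr
  have h5 : Real.log (4 * n + 1) ≤ n / 6 := by
    refine le_trans ?_ hmain
    nlinarith
  have h6 : (n : ℝ) ^ κ * Real.log (4 * n) ≤ n / 6 := by
    refine le_trans ?_ hmain
    gcongr
  have h7 : (n : ℝ) ^ κ * Real.log (4 * n) ≤ (primesBetween n).card * Real.log (4 * n) := by
    nlinarith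
  exact le_of_mul_le_mul_right h7 hlog40

/-- Numerators of the reduced fractions `a / p ^ D` within `r / 2` of `c`. -/
noncomputable def numerators (D : ℕ) (c r : ℝ) (p : ℕ) : Finset ℤ :=
  (Finset.Icc ⌈(p : ℝ) ^ D * (c - r / 2)⌉ ⌊(p : ℝ) ^ D * (c + r / 2)⌋).filter
    fun a => ¬ (p : ℤ) ∣ a

theorem mem_numerators {D p : ℕ} (hp : 0 < p) {c r : ℝ} {a : ℤ} :
    a ∈ numerators D c r p ↔ |(a : ℝ) / (p : ℝ) ^ D - c| ≤ r / 2 ∧ ¬ (p : ℤ) ∣ a := by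
  have hp' : (0 : ℝ) < (p : ℝ) ^ D := by positivity
  simp only [numerators, Finset.mem_filter, Finset.mem_Icc, Int.ceil_le, Int.le_floor, abs_le]
  refine and_congr_left fun _ => ?_
  rw [mul_comm, ← le_div_iff₀ hp', mul_comm ((p : ℝ) ^ D), ← div_le_iff₀ hp']
  constructor <;> rintro ⟨h1, h2⟩ <;> constructor <;> linarith

theorem le_card_numerators {D p : ℕ} (hp : 2 ≤ p) {c r : ℝ} (hr : 0 < r)
    (hrp : 8 ≤ r * (p : ℝ) ^ D) :
    r * (p : ℝ) ^ D / 4 ≤ (numerators D c r p).card := by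
  have hp' : (2 : ℝ) ≤ p := by exact_mod_cast hp
  set I := Finset.Icc ⌈(p : ℝ) ^ D * (c - r / 2)⌉ ⌊(p : ℝ) ^ D * (c + r / 2)⌋ with hI
  have hmem : ∀ a ∈ I, |(a : ℝ) - (p : ℝ) ^ D * c| ≤ r * (p : ℝ) ^ D / 2 := by
    intro a ha
    simp only [hI, Finset.mem_Icc, Int.ceil_le, Int.le_floor] at ha
    rw [abs_le]
    constructor <;> nlinarith [ha.1, ha.2]
  have hcard : r * (p : ℝ) ^ D - 1 ≤ I.card := by
    rw [hI, Int.card_Icc]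
    have h1 := Int.lt_floor_add_one ((p : ℝ) ^ D * (c + r / 2))
    have h2 := Int.ceil_lt_add_one ((p : ℝ) ^ D * (c - r / 2))
    have h3 : ((⌊(p : ℝ) ^ D * (c + r / 2)⌋ + 1 - ⌈(p : ℝ) ^ D * (c - r / 2)⌉ : ℤ) : ℝ) ≤
        ((⌊(p : ℝ) ^ D * (c + r / 2)⌋ + 1 - ⌈(p : ℝ) ^ D * (c - r / 2)⌉).toNat : ℝ) := by
      exact_mod_cast Int.self_le_toNat _
    push_cast at h3
    nlinarith
  -- Multiples of `p` are `p`-separated, so at most about half of the numerators are lost, as `p ≥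
  -- 2`.
  have hmul : ((I.filter fun a => (p : ℤ) ∣ a).card : ℝ) ≤
      1 + 2 * (r * (p : ℝ) ^ D / 2) / p := by
    refine card_le_of_separated _ (fun a : ℤ => (a : ℝ)) (u := (p : ℝ) ^ D * c) (by linarith)
      ?_ (fun a ha => hmem a (Finset.mem_filter.1 ha).1) (by positivity)
    intro a ha b hb hab
    have hdvd : (p : ℤ) ∣ a - b :=
      dvd_sub (Finset.mem_filter.1 ha).2 (Finset.mem_filter.1 hb).2
    have := Int.le_of_dvd (abs_pos.2 (sub_ne_zero.2 hab)) ((dvd_abs _ _).2 hdvd)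
    exact_mod_cast this
  have hmul2 : 2 * (r * (p : ℝ) ^ D / 2) / p ≤ r * (p : ℝ) ^ D / 2 := by
    rw [div_le_iff₀ (by linarith)]
    nlinarith
  have hadd : ((I.filter fun a => (p : ℤ) ∣ a).card : ℝ) + (numerators D c r p).card = I.card := by
    rw [numerators, ← hI]
    exact_mod_cast Finset.card_filter_add_card_filter_not _
  linarith

/-- The cross difference of the numerators is an integer, and nonzero: for `p ≠ p'`, equality would
give `p ∣ a * p' ^ D`, hence `p ∣ a`. -/
theorem separation_of_fractions {D p p' : ℕ} (hD : 1 ≤ D) (hp : p.Prime) (hp' : p'.Prime)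
    {M : ℝ} (hpM : (p : ℝ) ≤ M) (hpM' : (p' : ℝ) ≤ M) {a a' : ℤ} (ha : ¬ (p : ℤ) ∣ a)
    (hne : p = p' → a ≠ a') :
    1 / (M ^ D) ^ 2 ≤ |(a : ℝ) / (p : ℝ) ^ D - (a' : ℝ) / (p' : ℝ) ^ D| := by
  have hp0 : (0 : ℝ) < p := by exact_mod_cast hp.pos
  have hp0' : (0 : ℝ) < p' := by exact_mod_cast hp'.pos
  have hnum : a * (p' : ℤ) ^ D - a' * (p : ℤ) ^ D ≠ 0 := by
    intro h
    rw [sub_eq_zero] at h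
    by_cases hpp : p = p'
    · subst hpp
      have : ((p : ℤ) ^ D) ≠ 0 := by exact_mod_cast (pow_pos hp.pos D).ne'
      exact hne rfl (mul_right_cancel₀ this h)
    · have h1 : (p : ℤ) ∣ a * (p' : ℤ) ^ D := by
        rw [h]; exact dvd_mul_of_dvd_right (dvd_pow_self _ (by omega)) _
      rcases (Nat.prime_iff_prime_int.1 hp).dvd_or_dvd h1 with h2 | h2
      · exact ha h2
      · have h3 := (Nat.prime_iff_prime_int.1 hp).dvd_of_dvd_pow h2
        exact hpp ((Nat.prime_dvd_prime_iff_eq hp hp').1 (by exact_mod_cast h3))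
  have hint : (1 : ℝ) ≤ |(a : ℝ) * (p' : ℝ) ^ D - (a' : ℝ) * (p : ℝ) ^ D| := by
    exact_mod_cast Int.one_le_abs hnum
  rw [div_sub_div _ _ (by positivity) (by positivity), abs_div,
    abs_of_pos (by positivity : 0 < (p : ℝ) ^ D * (p' : ℝ) ^ D), mul_comm ((p : ℝ) ^ D) (a' : ℝ)]
  have hM : 0 < M := by linarith
  refine div_le_div₀ (abs_nonneg _) hint (by positivity) ?_
  rw [sq]
  gcongr

/-! ### The spread condition for the fractions -/

theorem le_mul_rpow_mul_rpow {s a c P Z : ℝ} (hs : 0 < s) (hs1 : s < 1) (ha : 0 < a) (hc : 0 ≤ c)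
    (hP : 0 ≤ P) (hZ : 0 ≤ Z) (h₁ : c ≤ a * P) (h₂ : c ≤ a * Z) :
    c ≤ a * (P ^ (1 - s) * Z ^ s) := by
  rw [← div_le_iff₀' ha] at h₁ h₂ ⊢
  rcases (div_nonneg hc ha.le).eq_or_lt with h | h
  · rw [← h]; positivity
  calc c / a = (c / a) ^ (1 - s) * (c / a) ^ s := by rw [← Real.rpow_add h]; simp
    _ ≤ _ := by gcongr

set_option maxHeartbeats 800000 in
-- Here `X` stands for the size of the denominators and `P` for the number of primes. Separation
-- across all denominators gives `hcount`, separation for each prime alone gives `hcount'`; which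
-- one is used depends on how `ℓ` compares with `w`, `X⁻²` and `X⁻¹`.
theorem isSpread_of_card_le {ι : Type*} {s B r w P X : ℝ} {y : ι → ℝ} {F : Finset ι}
    (hs : 0 < s) (hs1 : s < 1) (hB : 1 ≤ B) (hr : 0 < r) (hw : 0 < w) (hP : 0 < P) (hX : 0 < X)
    (hF : r * P * X / 4 ≤ F.card)
    (hcount : ∀ u L : ℝ, 0 ≤ L →
      ((F.filter fun i => |y i - u| ≤ L).card : ℝ) ≤ 1 + 2 * L * (B * X) ^ 2)
    (hcount' : ∀ u L : ℝ, 0 ≤ L →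
      ((F.filter fun i => |y i - u| ≤ L).card : ℝ) ≤ P * (1 + 2 * L * (B * X)))
    (hwX : 4 * w * (B * X) ^ 2 < 1) (hPX : 16 ≤ P * X * w ^ s * r ^ (1 - s))
    (hPs : 64 * B ^ 2 * (X ^ 2) ^ s ≤ r ^ (1 - s) * P ^ s * X) :
    IsSpread s (8 * (1 + 4 * B)) y F r w := by
  classical
  set C := 8 * (1 + 4 * B) with hC
  have hC1 : 1 ≤ C := by linarith
  refine ⟨by have : (0 : ℝ) < F.card := lt_of_lt_of_le (by positivity) hF
             exact_mod_cast this, fun u ℓ hℓ hℓr => ?_⟩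
  have hℓC : ℓ * C ≤ r := by rwa [le_div_iff₀ (by linarith)] at hℓr
  have hCpos : 0 < C := by linarith
  have hrs : r ^ (1 - s) * r ^ s = r := by rw [← Real.rpow_add hr]; simp
  have hRHS : P * X * r ^ (1 - s) * (ℓ * C) ^ s / 8 ≤ (F.card : ℝ) / 2 * (ℓ * C / r) ^ s := by
    calc P * X * r ^ (1 - s) * (ℓ * C) ^ s / 8
        = (r ^ (1 - s) * r ^ s) * P * X / 4 / 2 * (ℓ * C / r) ^ s := by
          rw [Real.div_rpow (by positivity) hr.le]; field_simp; ring
      _ ≤ _ := by rw [hrs]; gcongr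
  refine le_trans ?_ hRHS
  -- For `ℓ ≤ w` the radius `ℓ + w` is below half the separation, so at most one point is hit.
  rcases le_or_gt ℓ w with hlw | hlw
  · have hcard : ((F.filter fun i => |y i - u| ≤ ℓ + w).card : ℝ) ≤ 1 := by
      have h1 := hcount u (ℓ + w) (by positivity)
      have h2 : 2 * (ℓ + w) * (B * X) ^ 2 ≤ 4 * w * (B * X) ^ 2 :=
        mul_le_mul_of_nonneg_right (by linarith) (by positivity)
      have h3 : ((F.filter fun i => |y i - u| ≤ ℓ + w).card : ℝ) < 2 := by linarith
      have h4 : (F.filter fun i => |y i - u| ≤ ℓ + w).card < 2 := by exact_mod_cast h3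
      exact_mod_cast Nat.lt_succ_iff.1 h4
    calc _ ≤ (ℓ * C / w) ^ s * 1 :=
          mul_le_mul (min_le_right _ _) hcard (by positivity) (by positivity)
      _ = (ℓ * C) ^ s / w ^ s := by rw [mul_one, Real.div_rpow (by positivity) hw.le]
      _ ≤ _ := by
        rw [div_le_iff₀ (by positivity)]
        have : 0 < (ℓ * C) ^ s := by positivity
        nlinarith
  · have hLw : ∀ {v : ℝ}, 0 ≤ v → 2 * (ℓ + w) * v ≤ 4 * ℓ * v := fun hv =>
      mul_le_mul_of_nonneg_right (by linarith) hv
    have hc1 := (hcount u (ℓ + w) (by positivity)).trans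
      (add_le_add_right (hLw (by positivity : 0 ≤ (B * X) ^ 2)) 1)
    have hc2 := (hcount' u (ℓ + w) (by positivity)).trans
      (mul_le_mul_of_nonneg_left (add_le_add_right (hLw (by positivity : 0 ≤ B * X)) 1) hP.le)
    set cnt := ((F.filter fun i => |y i - u| ≤ ℓ + w).card : ℝ) with hcnt
    have hcnt0 : 0 ≤ cnt := Nat.cast_nonneg _
    have hmin : min 1 ((ℓ * C / w) ^ s) * cnt ≤ cnt :=
      mul_le_of_le_one_left hcnt0 (min_le_left _ _)
    refine hmin.trans ?_
    have hws : w ^ s ≤ (ℓ * C) ^ s := Real.rpow_le_rpow hw.le (by nlinarith) hs.le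
    -- Above scale `X⁻¹` the count is linear in `ℓ`; the factor `8 (1 + 4 B)` in `C` is what this
    -- case requires.
    rcases le_or_gt 1 (ℓ * X) with hlX | hlX
    · have h1 : cnt ≤ P * X * (ℓ * C) / 8 := by
        refine hc2.trans ?_
        have : 1 + 4 * ℓ * (B * X) ≤ ℓ * X * (1 + 4 * B) := by nlinarith
        calc P * (1 + 4 * ℓ * (B * X)) ≤ P * (ℓ * X * (1 + 4 * B)) := by gcongr
          _ = _ := by rw [hC]; ring
      have h2 : ℓ * C ≤ r ^ (1 - s) * (ℓ * C) ^ s := by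
        calc ℓ * C = (ℓ * C) ^ (1 - s) * (ℓ * C) ^ s := by
              rw [← Real.rpow_add (by positivity)]; simp
          _ ≤ _ := by gcongr
      calc cnt ≤ P * X * (ℓ * C) / 8 := h1
        _ ≤ P * X * (r ^ (1 - s) * (ℓ * C) ^ s) / 8 := by gcongr
        _ = _ := by ring
    -- At most two points are hit in the first case. Otherwise clustering is possible, and the
    -- bounds by multiples of `P` and of `ℓ X²` are interpolated with exponents `1 - s` and `s`.
    · rcases le_or_gt (4 * ℓ * (B * X) ^ 2) 1 with h1 | h1
      · have : 16 ≤ P * X * (ℓ * C) ^ s * r ^ (1 - s) := hPX.trans (by gcongr)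
        nlinarith
      · have ha : cnt ≤ 8 * B ^ 2 * P := by
          refine hc2.trans ?_
          have : 4 * ℓ * (B * X) ≤ 4 * B := by nlinarith
          have h3 : 1 + 4 * ℓ * (B * X) ≤ 8 * B ^ 2 := by nlinarith
          rw [mul_comm]
          exact mul_le_mul_of_nonneg_right h3 hP.le
        have hb : cnt ≤ 8 * B ^ 2 * (ℓ * X ^ 2) := by
          rw [mul_pow] at hc1 h1
          linarith
        have hab : cnt ≤ 8 * B ^ 2 * (P ^ (1 - s) * (ℓ * X ^ 2) ^ s) :=
          le_mul_rpow_mul_rpow hs hs1 (by positivity) hcnt0 hP.le (by positivity) ha hb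
        refine hab.trans ?_
        have hPP : P ^ (1 - s) * P ^ s = P := by rw [← Real.rpow_add hP]; simp
        have hCs : ℓ ^ s ≤ (ℓ * C) ^ s := Real.rpow_le_rpow hℓ.le (by nlinarith) hs.le
        rw [Real.mul_rpow hℓ.le (by positivity)]
        calc 8 * B ^ 2 * (P ^ (1 - s) * (ℓ ^ s * (X ^ 2) ^ s))
            = P ^ (1 - s) * (64 * B ^ 2 * (X ^ 2) ^ s) * ℓ ^ s / 8 := by ring
          _ ≤ P ^ (1 - s) * (r ^ (1 - s) * P ^ s * X) * ℓ ^ s / 8 := by gcongr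
          _ = (P ^ (1 - s) * P ^ s) * X * r ^ (1 - s) * ℓ ^ s / 8 := by ring
          _ ≤ _ := by rw [hPP]; gcongr

/-- The fraction `a / p ^ D` attached to the pair `(p, a)`. -/
noncomputable def fracPow (D : ℕ) (i : (_ : ℕ) × ℤ) : ℝ := (i.2 : ℝ) / (i.1 : ℝ) ^ D

/-- The reduced fractions `a / p ^ D` within `r / 2` of `c` with `p` a prime in `(n, 4n]`. -/
noncomputable def fractionsNear (D n : ℕ) (c r : ℝ) : Finset ((_ : ℕ) × ℤ) :=
  (primesBetween n).sigma (numerators D c r)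

theorem mem_primesBetween {n p : ℕ} :
    p ∈ primesBetween n ↔ (n < p ∧ p ≤ 4 * n) ∧ p.Prime := by
  simp [primesBetween]

theorem mem_fractionsNear {D n : ℕ} {c r : ℝ} {i : (_ : ℕ) × ℤ} :
    i ∈ fractionsNear D n c r ↔ ((n < i.1 ∧ i.1 ≤ 4 * n) ∧ i.1.Prime) ∧
      |fracPow D i - c| ≤ r / 2 ∧ ¬ (i.1 : ℤ) ∣ i.2 := by
  rw [fractionsNear, Finset.mem_sigma, mem_primesBetween]
  exact and_congr_right fun h => mem_numerators h.2.pos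

theorem le_card_fractionsNear {D n : ℕ} {c r : ℝ} (hr : 0 < r) (hrn : 8 ≤ r * (n : ℝ) ^ D) :
    r * (primesBetween n).card * (n : ℝ) ^ D / 4 ≤ (fractionsNear D n c r).card := by
  rw [fractionsNear, Finset.card_sigma]
  push_cast
  calc r * (primesBetween n).card * (n : ℝ) ^ D / 4
      = ∑ p ∈ primesBetween n, r * (n : ℝ) ^ D / 4 := by
        rw [Finset.sum_const, nsmul_eq_mul]; ring
    _ ≤ _ := by
      refine Finset.sum_le_sum fun p hp => ?_
      obtain ⟨⟨h1, -⟩, hpp⟩ := mem_primesBetween.1 hp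
      have hnp : (n : ℝ) ≤ p := by exact_mod_cast h1.le
      have hle : r * (n : ℝ) ^ D ≤ r * (p : ℝ) ^ D := by gcongr
      exact le_trans (by linarith) (le_card_numerators hpp.two_le hr (hrn.trans hle))

theorem card_filter_fractionsNear_le {D n : ℕ} (hD : 1 ≤ D) (hn : 0 < n) {c r : ℝ} (u : ℝ)
    {L : ℝ} (hL : 0 ≤ L) :
    (((fractionsNear D n c r).filter fun i => |fracPow D i - u| ≤ L).card : ℝ) ≤
      1 + 2 * L * (4 ^ D * (n : ℝ) ^ D) ^ 2 := by
  have hn' : (0 : ℝ) < n := by exact_mod_cast hn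
  have h := card_le_of_separated ((fractionsNear D n c r).filter fun i => |fracPow D i - u| ≤ L)
    (fracPow D) (g := 1 / ((4 * (n : ℝ)) ^ D) ^ 2) (L := L) (u := u) (by positivity) ?_
    (fun i hi => (Finset.mem_filter.1 hi).2) hL
  · rw [← mul_pow]
    calc _ ≤ _ := h
      _ = _ := by field_simp
  · intro i hi j hj hij
    obtain ⟨⟨⟨-, hi2⟩, hip⟩, -, hia⟩ := mem_fractionsNear.1 (Finset.mem_filter.1 hi).1
    obtain ⟨⟨⟨-, hj2⟩, hjp⟩, -, -⟩ := mem_fractionsNear.1 (Finset.mem_filter.1 hj).1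
    refine separation_of_fractions hD hip hjp (by exact_mod_cast hi2) (by exact_mod_cast hj2) hia ?_
    intro h1 h2
    exact hij (Sigma.ext h1 (heq_of_eq h2))

theorem card_filter_fractionsNear_le_primes {D n : ℕ} {c r : ℝ} (u : ℝ) {L : ℝ} (hL : 0 ≤ L) :
    (((fractionsNear D n c r).filter fun i => |fracPow D i - u| ≤ L).card : ℝ) ≤
      (primesBetween n).card * (1 + 2 * L * (4 ^ D * (n : ℝ) ^ D)) := by
  have hsub : ((fractionsNear D n c r).filter fun i => |fracPow D i - u| ≤ L) ⊆
      (primesBetween n).sigma fun p =>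
        (numerators D c r p).filter fun a : ℤ => |(a : ℝ) / (p : ℝ) ^ D - u| ≤ L := by
    intro i hi
    obtain ⟨hi1, hi2⟩ := Finset.mem_filter.1 hi
    obtain ⟨hi3, hi4⟩ := Finset.mem_sigma.1 hi1
    exact Finset.mem_sigma.2 ⟨hi3, Finset.mem_filter.2 ⟨hi4, hi2⟩⟩
  have hcard := Finset.card_le_card hsub
  rw [Finset.card_sigma] at hcard
  calc _ ≤ ((∑ p ∈ primesBetween n,
        ((numerators D c r p).filter fun a : ℤ => |(a : ℝ) / (p : ℝ) ^ D - u| ≤ L).card : ℕ) : ℝ) := by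
        exact_mod_cast hcard
    _ = ∑ p ∈ primesBetween n,
        (((numerators D c r p).filter fun a : ℤ => |(a : ℝ) / (p : ℝ) ^ D - u| ≤ L).card : ℝ) := by
        push_cast; rfl
    _ ≤ ∑ p ∈ primesBetween n, (1 + 2 * L * (4 ^ D * (n : ℝ) ^ D)) := by
      refine Finset.sum_le_sum fun p hp => ?_
      obtain ⟨⟨-, h1⟩, hpp⟩ := mem_primesBetween.1 hp
      have hp0 : (0 : ℝ) < p := by exact_mod_cast hpp.pos
      have hpn : (p : ℝ) ≤ 4 * n := by exact_mod_cast h1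
      have h := card_le_of_separated ((numerators D c r p).filter
        fun a : ℤ => |(a : ℝ) / (p : ℝ) ^ D - u| ≤ L) (fun a : ℤ => (a : ℝ) / (p : ℝ) ^ D)
        (g := 1 / (p : ℝ) ^ D) (L := L) (u := u) (by positivity) ?_
        (fun i hi => (Finset.mem_filter.1 hi).2) hL
      · refine h.trans ?_
        rw [div_div_eq_mul_div, div_one, ← mul_pow]
        gcongr
      · intro a _ b _ hab
        have : (1 : ℝ) ≤ |(a : ℝ) - b| := by
          exact_mod_cast Int.one_le_abs (sub_ne_zero.2 hab)
        rw [← sub_div, abs_div, abs_of_pos (by positivity : (0 : ℝ) < (p : ℝ) ^ D)]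
        gcongr
    _ = _ := by rw [Finset.sum_const, nsmul_eq_mul]

/-- `x` is approximated to within `n ^ (-ρ)` by a reduced fraction `a / p ^ D`, where `p` is a
prime in `(n, 4n]`. -/
def IsApproxBy (D : ℕ) (ρ : ℝ) (n : ℕ) (x : ℝ) : Prop :=
  ∃ p : ℕ, p.Prime ∧ n < p ∧ p ≤ 4 * n ∧ ∃ a : ℤ, ¬ (p : ℤ) ∣ a ∧
    |x - (a : ℝ) / (p : ℝ) ^ D| ≤ (n : ℝ) ^ (-ρ)

open Filter in
-- `ρ > 2 D` puts the balls below the separation of the fractions. `s ρ < D + 1` says that the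
-- `s`-weight of all `n ^ (D + 1)` balls is large. `s (2 D - 1) < D` handles the worst possible
-- cluster, one fraction for each of about `n` primes in an interval of length about `n ^ (1 - 2
-- D)`.
theorem le_dimH_isApproxBy {D : ℕ} {s ρ c₀ r₀ : ℝ} (hD : 1 ≤ D) (hs : 0 < s)
    (hs1 : s < 1) (hρ : 2 * (D : ℝ) < ρ) (hsρ : s * ρ < D + 1) (hsD : s * (2 * D - 1) < D)
    (hr₀ : 0 < r₀) :
    ENNReal.ofReal s ≤ dimH {x : ℝ | |x - c₀| ≤ r₀ ∧ ∀ m, ∃ n, m ≤ n ∧ IsApproxBy D ρ n x} := by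
  have hB : (1 : ℝ) ≤ 4 ^ D := one_le_pow₀ (by norm_num)
  have hD' : (1 : ℝ) ≤ D := by exact_mod_cast hD
  refine le_dimH_of_isSpread (y := fracPow D) (C := 8 * (1 + 4 * 4 ^ D)) hs (by positivity) hr₀ ?_
  intro c r hr m
  -- The number of primes is only bounded below by `n ^ κ` with `κ < 1`; the strict inequalities for
  -- `s` leave room for this loss.
  obtain ⟨κ, hκ, hκ1⟩ : ∃ κ, max (s * ρ - D) ((2 * D * s - D) / s) < κ ∧ κ < 1 := by
    refine exists_between (max_lt (by linarith) ?_)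
    rw [div_lt_one hs]; linarith
  rw [max_lt_iff, div_lt_iff₀ hs] at hκ
  obtain ⟨hκa, hκb⟩ := hκ
  have hrs : 0 < r ^ (1 - s) := by positivity
  obtain ⟨n, hP, h1, h2, h3, h4, h5, hn1, hnm⟩ :=
    ((eventually_rpow_le_card_primesBetween hκ1).and
    ((eventually_le_natCast_rpow (a := ρ - 2 * D) (by linarith) (4 * (4 ^ D) ^ 2 + 1)).and
    ((eventually_le_natCast_rpow (a := κ + D - ρ * s) (by linarith) (16 / r ^ (1 - s))).and
    ((eventually_le_natCast_rpow (a := κ * s + D - 2 * D * s) (by linarith)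
      (64 * (4 ^ D) ^ 2 / r ^ (1 - s))).and
    ((eventually_le_natCast_rpow (a := D) (by linarith) (8 / r)).and
    ((eventually_le_natCast_rpow (a := ρ) (by linarith) (2 / r)).and
    ((eventually_ge_atTop 1).and (eventually_ge_atTop m)))))))).exists
  have hn : (0 : ℝ) < n := by exact_mod_cast hn1
  have hX : (0 : ℝ) < (n : ℝ) ^ D := by positivity
  have hw : 0 < (n : ℝ) ^ (-ρ) := by positivity
  have hκpos : 0 < (n : ℝ) ^ κ := by positivity
  have hPpos : (0 : ℝ) < (primesBetween n).card := hκpos.trans_le hP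
  refine ⟨(n : ℝ) ^ (-ρ), hw, ?_, fractionsNear D n c r, ?_, ?_, ?_⟩
  · rw [Real.rpow_neg hn.le, inv_le_comm₀ (by positivity) (by positivity), inv_div]
    exact h5
  · exact fun i hi => (mem_fractionsNear.1 hi).2.1
  · intro i hi x hx
    obtain ⟨⟨⟨hi1, hi2⟩, hip⟩, -, hia⟩ := mem_fractionsNear.1 hi
    exact ⟨n, hnm, i.1, hip, hi1, hi2, i.2, hia, hx⟩
  · refine isSpread_of_card_le (P := (primesBetween n).card) (X := (n : ℝ) ^ D) hs hs1 hB hr hw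
      hPpos hX ?_ (fun u L hL => ?_) (fun u L hL => ?_) ?_ ?_ ?_
    · refine le_card_fractionsNear hr ?_
      rw [Real.rpow_natCast, div_le_iff₀ hr] at h4
      linarith
    · exact card_filter_fractionsNear_le hD hn1 u hL
    · exact card_filter_fractionsNear_le_primes u hL
    · have he : (n : ℝ) ^ (-ρ) * ((n : ℝ) ^ D) ^ 2 = ((n : ℝ) ^ (ρ - 2 * D))⁻¹ := by
        rw [← Real.rpow_neg hn.le, ← pow_mul, ← Real.rpow_natCast, ← Real.rpow_add hn]
        congr 1; push_cast; ring
      calc 4 * (n : ℝ) ^ (-ρ) * (4 ^ D * (n : ℝ) ^ D) ^ 2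
          = 4 * (4 ^ D) ^ 2 * ((n : ℝ) ^ (-ρ) * ((n : ℝ) ^ D) ^ 2) := by ring
        _ < 1 := by
          rw [he, ← div_eq_mul_inv, div_lt_one (by positivity)]
          linarith
    · rw [div_le_iff₀ hrs] at h2
      have he : (n : ℝ) ^ κ * (n : ℝ) ^ D * ((n : ℝ) ^ (-ρ)) ^ s = (n : ℝ) ^ (κ + D - ρ * s) := by
        rw [← Real.rpow_mul hn.le, ← Real.rpow_natCast, ← Real.rpow_add hn, ← Real.rpow_add hn]
        congr 1; ring
      rw [← he] at h2
      exact h2.trans (by gcongr)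
    · rw [div_le_iff₀ hrs] at h3
      have he : (n : ℝ) ^ (κ * s + D - 2 * D * s) * (((n : ℝ) ^ D) ^ 2) ^ s =
          ((n : ℝ) ^ κ) ^ s * (n : ℝ) ^ D := by
        rw [← pow_mul, ← Real.rpow_natCast, ← Real.rpow_natCast, ← Real.rpow_mul hn.le,
          ← Real.rpow_mul hn.le, ← Real.rpow_add hn, ← Real.rpow_add hn]
        congr 1; push_cast; ring
      calc 64 * (4 ^ D) ^ 2 * (((n : ℝ) ^ D) ^ 2) ^ s
          ≤ (n : ℝ) ^ (κ * s + D - 2 * D * s) * r ^ (1 - s) * (((n : ℝ) ^ D) ^ 2) ^ s := by gcongr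
        _ = r ^ (1 - s) * (((n : ℝ) ^ κ) ^ s * (n : ℝ) ^ D) := by rw [← he]; ring
        _ ≤ r ^ (1 - s) * (((primesBetween n).card : ℝ) ^ s * (n : ℝ) ^ D) := by gcongr
        _ = _ := by ring

/-! ### Perturbation of monomial sums and complete sums -/

theorem expChar_add (s t : ℝ) : expChar (s + t) = expChar s * expChar t := by
  simp only [expChar]
  rw [← Complex.exp_add]
  congr 1; push_cast; ring

theorem norm_expChar (t : ℝ) : ‖expChar t‖ = 1 := by
  rw [expChar, show 2 * (Real.pi : ℂ) * Complex.I * (t : ℂ) = ((2 * Real.pi * t : ℝ) : ℂ) * Complex.I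
    by push_cast; ring]
  exact Complex.norm_exp_ofReal_mul_I _

theorem norm_expChar_sub_le (s t : ℝ) : ‖expChar s - expChar t‖ ≤ 2 * Real.pi * |s - t| := by
  have h1 : expChar s - expChar t = expChar t * (expChar (s - t) - 1) := by
    rw [mul_sub, ← expChar_add]; ring_nf
  rw [h1, norm_mul, norm_expChar, one_mul, expChar,
    show 2 * (Real.pi : ℂ) * Complex.I * ((s - t : ℝ) : ℂ) =
      Complex.I * ((2 * Real.pi * (s - t) : ℝ) : ℂ) by push_cast; ring]
  refine (Real.norm_exp_I_mul_ofReal_sub_one_le).trans ?_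
  rw [Real.norm_eq_abs, abs_mul, abs_of_pos Real.two_pi_pos]

theorem norm_monomialSum_sub_le (d : ℕ) (x y : ℝ) (N : ℕ) :
    ‖monomialSum d x N - monomialSum d y N‖ ≤ 2 * Real.pi * |x - y| * (N : ℝ) ^ (d + 1) := by
  rw [monomialSum, monomialSum, ← Finset.sum_sub_distrib]
  have h : ∀ n ∈ Finset.Icc 1 N, ‖expChar (x * (n : ℝ) ^ d) - expChar (y * (n : ℝ) ^ d)‖ ≤
      2 * Real.pi * |x - y| * (N : ℝ) ^ d := by
    intro n hn
    refine (norm_expChar_sub_le _ _).trans ?_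
    have hnN : (n : ℝ) ≤ N := by exact_mod_cast (Finset.mem_Icc.1 hn).2
    rw [← sub_mul, abs_mul, abs_of_nonneg (by positivity : 0 ≤ (n : ℝ) ^ d), ← mul_assoc]
    gcongr
  refine (norm_sum_le_of_le _ h).trans (le_of_eq ?_)
  rw [Finset.sum_const, Nat.card_Icc, nsmul_eq_mul, pow_succ]
  simp only [Nat.add_sub_cancel]
  ring

theorem sum_range_zmod {q : ℕ} [NeZero q] (f : ZMod q → ℂ) :
    ∑ n ∈ Finset.range q, f n = ∑ x, f x := by
  refine Finset.sum_bij' (fun n _ => (n : ZMod q)) (fun x _ => x.val) (fun _ _ => Finset.mem_univ _)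
    (fun x _ => Finset.mem_range.2 x.val_lt) (fun n hn => ?_) (fun x _ => ?_) (fun _ _ => rfl)
  · exact ZMod.val_natCast_of_lt (Finset.mem_range.1 hn)
  · exact ZMod.natCast_zmod_val x

theorem sum_Icc_mul_zmod {q : ℕ} [NeZero q] (f : ZMod q → ℂ) (t : ℕ) :
    ∑ n ∈ Finset.Icc 1 (t * q), f n = t * ∑ x, f x := by
  have h : ∀ N : ℕ, ∑ n ∈ Finset.Icc 1 N, f n = ∑ n ∈ Finset.range N, f ((n + 1 : ℕ) : ZMod q) := by
    intro N
    rw [Finset.range_eq_Ico, Finset.sum_Ico_add' (fun n : ℕ => f n) 0 N 1]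
    rfl
  rw [h]
  induction t with
  | zero => simp
  | succ t ih =>
    rw [Nat.succ_mul, Finset.sum_range_add, ih]
    have h2 : ∑ n ∈ Finset.range q, f ((t * q + n + 1 : ℕ) : ZMod q) = ∑ x, f x := by
      rw [← Equiv.sum_comp (Equiv.addRight (1 : ZMod q)) f, ← sum_range_zmod]
      refine Finset.sum_congr rfl fun n _ => ?_
      simp
    rw [h2]
    push_cast; ring

theorem monomialSum_div (d : ℕ) {q : ℕ} [NeZero q] (a : ℤ) (t : ℕ) :
    monomialSum d ((a : ℝ) / q) (t * q) =
      t * ∑ x : ZMod q, ZMod.stdAddChar ((a : ZMod q) * x ^ d) := by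
  rw [← sum_Icc_mul_zmod, monomialSum]
  refine Finset.sum_congr rfl fun n _ => ?_
  have h : (a : ZMod q) * (n : ZMod q) ^ d = ((a * (n : ℤ) ^ d : ℤ) : ZMod q) := by push_cast; rfl
  rw [h, ZMod.stdAddChar_coe, expChar]
  congr 1; push_cast; ring

/-- The modulus of a quadratic Gauss sum to an odd prime modulus. -/
theorem norm_sq_sum_stdAddChar_sq {p : ℕ} [Fact p.Prime] (hp : p ≠ 2) {a : ZMod p} (ha : a ≠ 0) :
    ‖∑ x : ZMod p, ZMod.stdAddChar (a * x ^ 2)‖ ^ 2 = p := by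
  have h2 : (2 : ZMod p) ≠ 0 := by
    have := (ZMod.prime_ne_zero p 2 hp)
    simpa using this
  rw [← Complex.ofReal_inj]
  push_cast
  rw [← Complex.mul_conj', map_sum, Finset.sum_mul_sum, Finset.sum_comm]
  have h : ∀ y : ZMod p, ∑ x : ZMod p, ZMod.stdAddChar (a * x ^ 2) *
      (starRingEnd ℂ) (ZMod.stdAddChar (a * y ^ 2)) =
      ∑ h : ZMod p, ZMod.stdAddChar (a * h ^ 2) * ZMod.stdAddChar (y * (2 * a * h)) := by
    intro y
    -- After `x = y + h` the phase is linear in `y`, so summing over `y` leaves only `h = 0`.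
    rw [← Equiv.sum_comp (Equiv.addRight y)]
    refine Finset.sum_congr rfl fun h _ => ?_
    rw [← AddChar.map_neg_eq_conj, ← AddChar.map_add_eq_mul, ← AddChar.map_add_eq_mul]
    congr 1
    simp only [Equiv.coe_addRight]
    ring
  simp_rw [h]
  rw [Finset.sum_comm]
  simp_rw [← Finset.mul_sum, AddChar.sum_mulShift _ (ZMod.isPrimitive_stdAddChar p)]
  rw [Finset.sum_eq_single 0]
  · simp [ZMod.card]
  · intro h _ hh
    simp [h2, ha, hh]
  · simp

theorem sum_pow_range_eq_zero {ζ : ℂ} {p : ℕ} (h : ζ ^ p = 1) (h1 : ζ ≠ 1) :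
    ∑ t ∈ Finset.range p, ζ ^ t = 0 := by
  have := mul_geom_sum ζ p
  rw [h, sub_self] at this
  exact (mul_eq_zero.1 this).resolve_left (sub_ne_zero.2 h1)

/-- The complete sum of `e(a x ^ d / p ^ d)` counts the residues divisible by `p`. -/
theorem pow_le_norm_sum_stdAddChar_pow {d p : ℕ} (hd : 2 ≤ d) (hp : p.Prime) (hpd : ¬ p ∣ d)
    {a : ℤ} (ha : ¬ (p : ℤ) ∣ a) [NeZero (p ^ d)] :
    (p : ℝ) ^ (d - 1) ≤ ‖∑ x : ZMod (p ^ d), ZMod.stdAddChar ((a : ZMod (p ^ d)) * x ^ d)‖ := by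
  have hpow : p ^ d = p ^ (d - 1) * p := by rw [← pow_succ]; congr 1; omega
  -- Since `2 (d - 1) ≥ d`, a shift by `t * p ^ (d - 1)` changes `x ^ d` only by its linear term.
  have hsq : ((p : ZMod (p ^ d)) ^ (d - 1)) ^ 2 = 0 := by
    rw [← pow_mul, ← Nat.cast_pow, ZMod.natCast_eq_zero_iff]
    exact pow_dvd_pow _ (by omega)
  have hpp : (p : ZMod (p ^ d)) ^ (d - 1) * p = 0 := by
    rw [← Nat.cast_pow, ← Nat.cast_mul, ← hpow, ZMod.natCast_self]
  have hp0 : 0 < p := hp.pos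
  have hdvd : ∀ x : ZMod (p ^ d),
      (a : ZMod (p ^ d)) * ((d : ZMod (p ^ d)) * x ^ (d - 1)) * (p : ZMod (p ^ d)) ^ (d - 1) = 0 ↔ p ∣ x.val := by
    intro x
    have h1 : (a : ZMod (p ^ d)) * ((d : ZMod (p ^ d)) * x ^ (d - 1)) * (p : ZMod (p ^ d)) ^ (d - 1) =
        ((a * (d * (x.val : ℤ) ^ (d - 1)) * (p : ℤ) ^ (d - 1) : ℤ) : ZMod (p ^ d)) := by
      push_cast
      rw [ZMod.natCast_zmod_val]
    have h2 : ((p ^ d : ℕ) : ℤ) = p * (p : ℤ) ^ (d - 1) := by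
      rw [hpow]; push_cast; ring
    have hpZ := Nat.prime_iff_prime_int.1 hp
    rw [h1, ZMod.intCast_zmod_eq_zero_iff_dvd, h2,
      mul_dvd_mul_iff_right (pow_ne_zero _ hpZ.ne_zero), hpZ.dvd_mul, hpZ.dvd_mul,
      hpZ.dvd_pow_iff_dvd (by omega)]
    simp only [ha, false_or, Int.natCast_dvd_natCast, hpd]
  set S := ∑ x : ZMod (p ^ d), ZMod.stdAddChar ((a : ZMod (p ^ d)) * x ^ d) with hS
  have hshift : ∀ t : ℕ, S = ∑ x : ZMod (p ^ d), ZMod.stdAddChar ((a : ZMod (p ^ d)) * x ^ d) *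
      ZMod.stdAddChar ((a : ZMod (p ^ d)) * ((d : ZMod (p ^ d)) * x ^ (d - 1)) * (p : ZMod (p ^ d)) ^ (d - 1)) ^ t := by
    intro t
    rw [hS, ← Equiv.sum_comp (Equiv.addRight ((t : ZMod (p ^ d)) * (p : ZMod (p ^ d)) ^ (d - 1)))]
    refine Finset.sum_congr rfl fun x _ => ?_
    rw [← AddChar.map_nsmul_eq_pow, ← AddChar.map_add_eq_mul]
    congr 1
    obtain ⟨k, hk⟩ := Polynomial.powAddExpansion x ((t : ZMod (p ^ d)) * (p : ZMod (p ^ d)) ^ (d - 1)) d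
    simp only [Equiv.coe_addRight]
    rw [hk, mul_pow, hsq, nsmul_eq_mul]
    ring
  -- Averaging over the shifts `t < p`: each `x` not divisible by `p` yields a vanishing geometric
  -- sum, and each multiple of `p` has `x ^ d = 0`.
  have hpS : (p : ℂ) * S = p * ((Finset.univ.filter fun x : ZMod (p ^ d) => p ∣ x.val).card : ℂ) := by
    calc (p : ℂ) * S = ∑ t ∈ Finset.range p, S := by simp
      _ = ∑ x : ZMod (p ^ d), ZMod.stdAddChar ((a : ZMod (p ^ d)) * x ^ d) * ∑ t ∈ Finset.range p,
          ZMod.stdAddChar ((a : ZMod (p ^ d)) * ((d : ZMod (p ^ d)) * x ^ (d - 1)) *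
            (p : ZMod (p ^ d)) ^ (d - 1)) ^ t := by
        rw [Finset.sum_congr rfl fun t _ => hshift t, Finset.sum_comm]
        simp_rw [Finset.mul_sum]
      _ = ∑ x : ZMod (p ^ d), if p ∣ x.val then (p : ℂ) else 0 := by
        refine Finset.sum_congr rfl fun x _ => ?_
        split_ifs with hx
        · have hx0 : x ^ d = 0 := by
            rw [← ZMod.natCast_zmod_val x, ← Nat.cast_pow, ZMod.natCast_eq_zero_iff]
            exact pow_dvd_pow_of_dvd hx d
          rw [(hdvd x).2 hx, hx0]
          simp
        · rw [sum_pow_range_eq_zero, mul_zero]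
          · rw [← AddChar.map_nsmul_eq_pow, nsmul_eq_mul, mul_comm, mul_assoc, hpp, mul_zero,
              AddChar.map_zero_eq_one]
          · intro h
            rw [← AddChar.map_zero_eq_one (ZMod.stdAddChar (N := p ^ d))] at h
            exact hx ((hdvd x).1 (ZMod.injective_stdAddChar h))
      _ = _ := by
        rw [← Finset.sum_filter, Finset.sum_const, nsmul_eq_mul, mul_comm]
  have hS' := mul_left_cancel₀ (by exact_mod_cast hp0.ne' : (p : ℂ) ≠ 0) hpS
  rw [hS', Complex.norm_natCast]
  have hcard : (Finset.range (p ^ (d - 1))).card ≤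
      (Finset.univ.filter fun x : ZMod (p ^ d) => p ∣ x.val).card := by
    have hlt : ∀ k ∈ Finset.range (p ^ (d - 1)), k * p < p ^ d := fun k hk => by
      rw [hpow]; exact Nat.mul_lt_mul_of_pos_right (Finset.mem_range.1 hk) hp0
    refine Finset.card_le_card_of_injOn (fun k => ((k * p : ℕ) : ZMod (p ^ d))) (fun k hk => ?_)
      (fun k hk l hl hkl => ?_)
    · simp only [Finset.coe_filter, Finset.mem_univ, true_and, Set.mem_ofPred_eq]
      rw [ZMod.val_natCast_of_lt (hlt k hk)]
      exact dvd_mul_left _ _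
    · have := congrArg ZMod.val hkl
      simp only [ZMod.val_natCast_of_lt (hlt k hk), ZMod.val_natCast_of_lt (hlt l hl)] at this
      exact Nat.eq_of_mul_eq_mul_right hp0 this
  rw [Finset.card_range] at hcard
  exact_mod_cast hcard

theorem le_norm_monomialSum_two {p : ℕ} (hp : p.Prime) (hp2 : p ≠ 2) {a : ℤ} (ha : ¬ (p : ℤ) ∣ a)
    (t : ℕ) : (t : ℝ) * (p : ℝ) ^ 1 * (p : ℝ) ^ (-(1 / 2) : ℝ) ≤
      ‖monomialSum 2 ((a : ℝ) / (p : ℝ) ^ 1) (t * p ^ 1)‖ := by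
  have : Fact p.Prime := ⟨hp⟩
  have hp0 : (0 : ℝ) < p := by exact_mod_cast hp.pos
  have ha' : (a : ZMod p) ≠ 0 := by rwa [Ne, ZMod.intCast_zmod_eq_zero_iff_dvd]
  have h := norm_sq_sum_stdAddChar_sq hp2 ha'
  rw [pow_one, pow_one, monomialSum_div, norm_mul, Complex.norm_natCast,
    ← Real.sqrt_sq (norm_nonneg (∑ x : ZMod p, ZMod.stdAddChar ((a : ZMod p) * x ^ 2))), h,
    Real.sqrt_eq_rpow, mul_assoc]
  refine mul_le_mul_of_nonneg_left (le_of_eq ?_) (Nat.cast_nonneg _)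
  nth_rw 1 [← Real.rpow_one (p : ℝ)]
  rw [← Real.rpow_add hp0]
  norm_num

theorem le_norm_monomialSum_pow {d p : ℕ} (hd : 2 ≤ d) (hp : p.Prime) (hpd : ¬ p ∣ d)
    {a : ℤ} (ha : ¬ (p : ℤ) ∣ a) (t : ℕ) :
    (t : ℝ) * (p : ℝ) ^ d * (p : ℝ) ^ (-1 : ℝ) ≤
      ‖monomialSum d ((a : ℝ) / (p : ℝ) ^ d) (t * p ^ d)‖ := by
  have hp0 : (0 : ℝ) < p := by exact_mod_cast hp.pos
  have : NeZero (p ^ d) := ⟨(pow_pos hp.pos d).ne'⟩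
  have h := pow_le_norm_sum_stdAddChar_pow hd hp hpd ha
  rw [← Nat.cast_pow, monomialSum_div, norm_mul, Complex.norm_natCast, mul_assoc]
  refine mul_le_mul_of_nonneg_left (le_trans (le_of_eq ?_) h) (Nat.cast_nonneg _)
  rw [Real.rpow_neg_one, Nat.cast_pow]
  obtain ⟨k, rfl⟩ : ∃ k, d = k + 1 := ⟨d - 1, by omega⟩
  rw [pow_succ, Nat.add_sub_cancel]
  field_simp

/-! ### From approximation by fractions to the exceptional set -/

open Filter in
theorem mem_exceptionalSet_of_isApproxBy {d D : ℕ} {b α ρ τ x : ℝ} (hD : 1 ≤ D)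
    (hb : 0 < b) (hτ0 : 0 < τ) (hτ : (1 - α) * τ = 1) (hDτ : D ≤ b * τ)
    (hρ : b * (τ * d + 1) < ρ)
    (hsum : ∃ p₀ : ℕ, ∀ p : ℕ, p₀ ≤ p → p.Prime → ∀ a : ℤ, ¬ (p : ℤ) ∣ a → ∀ t : ℕ,
      (t : ℝ) * (p : ℝ) ^ D * (p : ℝ) ^ (-b) ≤ ‖monomialSum d ((a : ℝ) / (p : ℝ) ^ D) (t * p ^ D)‖)
    (hx0 : 0 ≤ x) (hx1 : x < 1) (hx : ∀ m, ∃ n, m ≤ n ∧ IsApproxBy D ρ n x) :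
    x ∈ exceptionalSet α d := by
  refine ⟨⟨hx0, hx1⟩, Set.infinite_of_forall_exists_gt fun M => ?_⟩
  obtain ⟨p₀, hsum⟩ := hsum
  -- The constant left over from `N ≤ 2 (2 * 4 ^ b) ^ τ n ^ (b τ)` and `p ≤ 4 n` when `4 π N ^ d p ^
  -- b` is compared with a power of `n`.
  set K : ℝ := 4 * Real.pi * (2 * (2 * 4 ^ b) ^ τ) ^ d * 4 ^ b with hK
  obtain ⟨m, hm⟩ := eventually_atTop.1
    (eventually_le_natCast_rpow (a := ρ - b * (τ * d + 1)) (by linarith) K)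
  obtain ⟨n, hn, p, hp, hnp, hpn, a, ha, hxa⟩ := hx (max m (max (M + 1) p₀))
  simp only [max_le_iff] at hn
  obtain ⟨hnm, hnM, hnp₀⟩ := hn
  have hKn := hm n hnm
  have hn0 : (0 : ℝ) < n := by exact_mod_cast (by omega : 0 < n)
  have hp0 : (0 : ℝ) < p := by exact_mod_cast hp.pos
  have hp1 : (1 : ℝ) ≤ p := by exact_mod_cast hp.one_le
  have hpn' : (p : ℝ) ≤ 4 * n := by exact_mod_cast hpn
  -- This makes `T ^ (1 - α) = 2 p ^ b`, so `N ≥ T` yields a main term of at least `2 N ^ α`. As `p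
  -- ^ D ≤ T` by `hDτ`, rounding up to a multiple of `p ^ D` at most doubles `T`.
  set T : ℝ := (2 * (p : ℝ) ^ b) ^ τ with hT
  have hTpos : 0 < T := by positivity
  have hq0 : (0 : ℝ) < (p : ℝ) ^ D := by positivity
  set t : ℕ := ⌈T / (p : ℝ) ^ D⌉₊ with ht
  have htpos : 0 < t := Nat.ceil_pos.2 (by positivity)
  set N : ℕ := t * p ^ D with hN
  have hNR : (N : ℝ) = t * (p : ℝ) ^ D := by rw [hN]; push_cast; rfl
  have hNT : T ≤ N := by
    rw [hNR, ← div_le_iff₀ hq0]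
    exact Nat.le_ceil _
  have hqT : (p : ℝ) ^ D ≤ T := by
    calc (p : ℝ) ^ D = (p : ℝ) ^ (D : ℝ) := (Real.rpow_natCast _ _).symm
      _ ≤ (p : ℝ) ^ (b * τ) := Real.rpow_le_rpow_of_exponent_le hp1 hDτ
      _ = ((p : ℝ) ^ b) ^ τ := Real.rpow_mul hp0.le _ _
      _ ≤ T := by
        refine Real.rpow_le_rpow (by positivity) ?_ hτ0.le
        have : 0 < (p : ℝ) ^ b := by positivity
        linarith
  have hNle : (N : ℝ) ≤ 2 * T := by
    have h1 : (t : ℝ) ≤ T / (p : ℝ) ^ D + 1 := (Nat.ceil_lt_add_one (by positivity)).le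
    calc (N : ℝ) ≤ (T / (p : ℝ) ^ D + 1) * (p : ℝ) ^ D := by rw [hNR]; gcongr
      _ = T + (p : ℝ) ^ D := by field_simp
      _ ≤ _ := by linarith
  have hNn : (N : ℝ) ≤ 2 * (2 * 4 ^ b) ^ τ * (n : ℝ) ^ (b * τ) := by
    refine hNle.trans ?_
    calc 2 * T ≤ 2 * (2 * (4 * (n : ℝ)) ^ b) ^ τ := by
          rw [hT]; gcongr
      _ = 2 * ((2 * 4 ^ b) * (n : ℝ) ^ b) ^ τ := by
          rw [Real.mul_rpow (by norm_num) hn0.le]; ring_nf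
      _ = _ := by
          rw [Real.mul_rpow (by positivity) (by positivity), ← Real.rpow_mul hn0.le]; ring
  have hNpos : (0 : ℝ) < N := hTpos.trans_le hNT
  have hpN : p ≤ N := by
    calc p = p ^ 1 := (pow_one p).symm
      _ ≤ p ^ D := Nat.pow_le_pow_right hp.pos hD
      _ ≤ N := Nat.le_mul_of_pos_left _ htpos
  have hmain : 2 * (N : ℝ) ^ α ≤ N * (p : ℝ) ^ (-b) := by
    have h1 : 2 * (p : ℝ) ^ b ≤ (N : ℝ) ^ (1 - α) := by
      have hα : 0 < 1 - α := by
        by_contra! h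
        nlinarith
      calc 2 * (p : ℝ) ^ b = T ^ (1 - α) := by
            rw [hT, ← Real.rpow_mul (by positivity), mul_comm τ, hτ, Real.rpow_one]
        _ ≤ _ := Real.rpow_le_rpow hTpos.le hNT hα.le
    have h2 : (N : ℝ) = (N : ℝ) ^ α * (N : ℝ) ^ (1 - α) := by
      rw [← Real.rpow_add hNpos]; simp
    rw [Real.rpow_neg hp0.le, ← div_eq_mul_inv, le_div_iff₀ (by positivity)]
    calc 2 * (N : ℝ) ^ α * (p : ℝ) ^ b = (N : ℝ) ^ α * (2 * (p : ℝ) ^ b) := by ring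
      _ ≤ (N : ℝ) ^ α * (N : ℝ) ^ (1 - α) := by gcongr
      _ = N := h2.symm
  have herr : 2 * Real.pi * |x - (a : ℝ) / (p : ℝ) ^ D| * (N : ℝ) ^ (d + 1) ≤
      N * (p : ℝ) ^ (-b) / 2 := by
    have h1 : 4 * Real.pi * (N : ℝ) ^ d * (p : ℝ) ^ b ≤ (n : ℝ) ^ ρ := by
      calc 4 * Real.pi * (N : ℝ) ^ d * (p : ℝ) ^ b
          ≤ 4 * Real.pi * (2 * (2 * 4 ^ b) ^ τ * (n : ℝ) ^ (b * τ)) ^ d * (4 * (n : ℝ)) ^ b := by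
            gcongr
        _ = K * (n : ℝ) ^ (b * (τ * d + 1)) := by
            have he : (n : ℝ) ^ (b * (τ * d + 1)) = ((n : ℝ) ^ (b * τ)) ^ d * (n : ℝ) ^ b := by
              rw [← Real.rpow_mul_natCast hn0.le, ← Real.rpow_add hn0]; ring_nf
            rw [mul_pow _ ((n : ℝ) ^ (b * τ)), Real.mul_rpow (by norm_num) hn0.le, he, hK]; ring
        _ ≤ (n : ℝ) ^ (ρ - b * (τ * d + 1)) * (n : ℝ) ^ (b * (τ * d + 1)) := by gcongr
        _ = (n : ℝ) ^ ρ := by rw [← Real.rpow_add hn0]; ring_nf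
    have hpb : (p : ℝ) ^ b * (p : ℝ) ^ (-b) = 1 := by rw [← Real.rpow_add hp0]; simp
    have hnρ : (n : ℝ) ^ (-ρ) * (n : ℝ) ^ ρ = 1 := by rw [← Real.rpow_add hn0]; simp
    calc 2 * Real.pi * |x - (a : ℝ) / (p : ℝ) ^ D| * (N : ℝ) ^ (d + 1)
        ≤ 2 * Real.pi * (n : ℝ) ^ (-ρ) * (N : ℝ) ^ (d + 1) := by gcongr
      _ = (n : ℝ) ^ (-ρ) * (4 * Real.pi * (N : ℝ) ^ d * (p : ℝ) ^ b) *
          (N * (p : ℝ) ^ (-b)) / 2 := by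
          rw [pow_succ]
          linear_combination (-2 * Real.pi * (n : ℝ) ^ (-ρ) * (N : ℝ) ^ d * N) * hpb
      _ ≤ (n : ℝ) ^ (-ρ) * (n : ℝ) ^ ρ * (N * (p : ℝ) ^ (-b)) / 2 := by gcongr
      _ = _ := by rw [hnρ, one_mul]
  refine ⟨N, ⟨by omega, ?_⟩, by omega⟩
  have h1 := hsum p (by omega) hp a ha t
  rw [← hNR, ← hN] at h1
  have h2 := (norm_monomialSum_sub_le d x ((a : ℝ) / (p : ℝ) ^ D) N).trans herr
  have h3 := norm_sub_norm_le (monomialSum d ((a : ℝ) / (p : ℝ) ^ D) N) (monomialSum d x N)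
  rw [norm_sub_rev] at h3
  linarith

theorem exceptionalSet_anti {α β : ℝ} (h : α ≤ β) (d : ℕ) :
    exceptionalSet β d ⊆ exceptionalSet α d := by
  rintro x ⟨hx, hinf⟩
  refine ⟨hx, hinf.mono ?_⟩
  rintro N ⟨hN, hle⟩
  exact ⟨hN, (Real.rpow_le_rpow_of_exponent_le (by exact_mod_cast hN) h).trans hle⟩

theorem le_dimH_exceptionalSet {d D : ℕ} {b β τ : ℝ} (hD : 1 ≤ D) (hb : 0 < b) (hτ0 : 0 < τ)
    (hτ : (1 - β) * τ = 1) (hDτ : D ≤ b * τ)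
    (hs : ((D : ℝ) + 1) / (b * (τ * d + 1)) * (2 * D - 1) ≤ D)
    (hsum : ∃ p₀ : ℕ, ∀ p : ℕ, p₀ ≤ p → p.Prime → ∀ a : ℤ, ¬ (p : ℤ) ∣ a → ∀ t : ℕ,
      (t : ℝ) * (p : ℝ) ^ D * (p : ℝ) ^ (-b) ≤
        ‖monomialSum d ((a : ℝ) / (p : ℝ) ^ D) (t * p ^ D)‖) :
    ENNReal.ofReal (((D : ℝ) + 1) / (b * (τ * d + 1))) ≤ dimH (exceptionalSet β d) := by
  have hD' : (1 : ℝ) ≤ D := by exact_mod_cast hD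
  by_contra! hlt
  obtain ⟨s, -, hs1, hs2⟩ := ENNReal.lt_iff_exists_real_btwn.1 hlt
  have hs0 : 0 < s := ENNReal.ofReal_pos.1 (pos_of_gt hs1)
  have hss : s < ((D : ℝ) + 1) / (b * (τ * d + 1)) := (ENNReal.ofReal_lt_ofReal_iff'.1 hs2).1
  have hsD : s * (2 * D - 1) < D := lt_of_lt_of_le (by gcongr; linarith) hs
  have hslt : s < 1 := by
    by_contra! h
    nlinarith
  have hpos : 0 < b * (τ * d + 1) := by positivity
  -- The bound `2 D < (D + 1) / s` is the sum of `s (2 D - 1) < D` and `s < 1`.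
  obtain ⟨ρ, hρ1, hρ2⟩ : ∃ ρ, max (2 * (D : ℝ)) (b * (τ * d + 1)) < ρ ∧ ρ < (D + 1) / s := by
    refine exists_between (max_lt ?_ ?_)
    · rw [lt_div_iff₀ hs0]; nlinarith
    · rw [lt_div_iff₀ hs0]
      rw [lt_div_iff₀ hpos] at hss
      linarith
  rw [max_lt_iff] at hρ1
  rw [lt_div_iff₀ hs0] at hρ2
  refine absurd hs1 (not_lt.2 ?_)
  -- The interval `[1/4, 3/4]` lies inside `[0, 1)`.
  refine (le_dimH_isApproxBy (c₀ := 1 / 2) (r₀ := 1 / 4) hD hs0 hslt hρ1.1 (by linarith) hsD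
    (by norm_num)).trans (dimH_mono ?_)
  rintro x ⟨hx, hxa⟩
  rw [abs_le] at hx
  exact mem_exceptionalSet_of_isApproxBy hD hb hτ0 hτ hDτ hρ1.2 hsum (by linarith) (by linarith) hxa

theorem le_dimH_exceptionalSet_two {β : ℝ} (hβ : 1 / 2 ≤ β) (hβ1 : β < 1) :
    ENNReal.ofReal (4 * (1 - β) / (3 - β)) ≤ dimH (exceptionalSet β 2) := by
  have hβ0 : 0 < 1 - β := by linarith
  have h3 : 0 < 3 - β := by linarith
  have heq : (((1 : ℕ) : ℝ) + 1) / (1 / 2 * (1 / (1 - β) * ((2 : ℕ) : ℝ) + 1)) =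
      4 * (1 - β) / (3 - β) := by
    have : 1 / (1 - β) * 2 + 1 = (3 - β) / (1 - β) := by field_simp; ring
    push_cast
    rw [this]
    field_simp
    norm_num
  rw [← heq]
  refine le_dimH_exceptionalSet le_rfl (by norm_num) (by positivity) (by field_simp) ?_ ?_ ?_
  · rw [Nat.cast_one, ← div_eq_mul_one_div, div_div, le_div_iff₀ (by positivity)]
    linarith
  · rw [heq]
    push_cast
    rw [div_mul_eq_mul_div, div_le_one h3]
    linarith
  -- Starting at 3 excludes the prime 2, where the Gauss sum evaluation fails.
  · exact ⟨3, fun p hp hpp a ha t => le_norm_monomialSum_two hpp (by omega) ha t⟩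

theorem le_dimH_exceptionalSet_of_three_le {d : ℕ} (hd : 3 ≤ d) {β : ℝ} (hβ : 1 - 1 / (d : ℝ) ≤ β)
    (hβ1 : β < 1) :
    ENNReal.ofReal (((d : ℝ) + 1) * (1 - β) / (d + 1 - β)) ≤ dimH (exceptionalSet β d) := by
  have hd' : (3 : ℝ) ≤ d := by exact_mod_cast hd
  have hβ0 : 0 < 1 - β := by linarith
  have h3 : 0 < (d : ℝ) + 1 - β := by linarith
  have hdβ : d * (1 - β) ≤ 1 := by
    have h : 1 - β ≤ 1 / (d : ℝ) := by linarith
    rwa [le_div_iff₀ (by linarith), mul_comm] at h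
  have heq : ((d : ℝ) + 1) / (1 * (1 / (1 - β) * (d : ℝ) + 1)) =
      ((d : ℝ) + 1) * (1 - β) / (d + 1 - β) := by
    have : 1 / (1 - β) * (d : ℝ) + 1 = (d + 1 - β) / (1 - β) := by field_simp; ring
    rw [this]
    field_simp
  rw [← heq]
  refine le_dimH_exceptionalSet (by omega) one_pos (by positivity) (by field_simp) ?_ ?_ ?_
  · rw [one_mul, le_div_iff₀ hβ0]; exact hdβ
  · rw [heq, div_mul_eq_mul_div, div_le_iff₀ h3]
    have h1 : ((d : ℝ) + 1) * (2 * d - 1) * (1 - β) * d ≤ (d + 1) * (2 * d - 1) * 1 := by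
      rw [mul_assoc, mul_comm (1 - β)]
      exact mul_le_mul_of_nonneg_left hdβ (by nlinarith)
    -- This needs `d ≥ 3`: it fails for `d = 2`.
    have h2 : ((d : ℝ) + 1) * (2 * d - 1) ≤ d * d * d := by nlinarith
    refine le_of_mul_le_mul_right (?_ : _ * (d : ℝ) ≤ _ * (d : ℝ)) (by linarith)
    nlinarith [mul_pos (mul_pos (by linarith : (0 : ℝ) < d) (by linarith : (0 : ℝ) < d)) hβ0]
  -- Primes exceeding `d` do not divide it, so the derivative of `x ^ d` vanishes modulo `p` only at
  -- multiples of `p`.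
  · refine ⟨d + 1, fun p hp hpp a ha t => le_norm_monomialSum_pow (by omega) hpp ?_ ha t⟩
    exact fun h => by have := Nat.le_of_dvd (by omega) h; omega

theorem theorem1p7 (α : ℝ) (hα0 : 0 < α) (hα1 : α < 1) :
    ENNReal.ofReal (min (4 / 5) (4 * (1 - α) / (3 - α))) ≤ dimH (exceptionalSet α 2) ∧
    ∀ d : ℕ, 3 ≤ d →
      ENNReal.ofReal
          (min (((d : ℝ) + 1) / ((d : ℝ) ^ 2 + 1))
            (((d : ℝ) + 1) * (1 - α) / ((d : ℝ) + 1 - α)))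
        ≤ dimH (exceptionalSet α d) := by
  refine ⟨?_, fun d hd => ?_⟩
  · rcases le_total (1 / 2) α with h | h
    · exact (ENNReal.ofReal_le_ofReal (min_le_right _ _)).trans (le_dimH_exceptionalSet_two h hα1)
    · refine (ENNReal.ofReal_le_ofReal (min_le_left _ _)).trans
        (le_trans ?_ (dimH_mono (exceptionalSet_anti h 2)))
      -- At the threshold `1/2` the bound equals `4/5`; likewise `1 - 1/d` gives `(d + 1) / (d ^ 2 +
      -- 1)` below.
      convert! le_dimH_exceptionalSet_two (le_refl (1 / 2 : ℝ)) (by norm_num) using 2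
      norm_num
  · have hd' : (3 : ℝ) ≤ d := by exact_mod_cast hd
    rcases le_total (1 - 1 / (d : ℝ)) α with h | h
    · exact (ENNReal.ofReal_le_ofReal (min_le_right _ _)).trans
        (le_dimH_exceptionalSet_of_three_le hd h hα1)
    · refine (ENNReal.ofReal_le_ofReal (min_le_left _ _)).trans
        (le_trans ?_ (dimH_mono (exceptionalSet_anti h d)))
      have hpos : 0 < 1 / (d : ℝ) := by positivity
      convert! le_dimH_exceptionalSet_of_three_le hd (le_refl (1 - 1 / (d : ℝ))) (by linarith)
        using 2
      have h1 : (d : ℝ) + 1 - (1 - 1 / d) = (d ^ 2 + 1) / d := by field_simp; ring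
      rw [h1]
      field_simp
      ring
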